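/- Let $f=(f_{ij})$ be a symmetric $2$-tensor field on $\mathbb{R}^2$ whose components $f_{ij}=f_{ji}$ are real-valued Schwartz functions. For $q\ge 0$ and $(x,\xi)\in T\mathbb{S}^1=\{(x,\xi)\in\mathbb{R}^2\times\mathbb{R}^2: |\xi|=1,\ \langle x,\xi\rangle=0\}$ put $$I^q f(x,\xi)=\int_{-\infty}^{\infty} t^q \sum_{i,j=1}^{2} f_{ij}(x+t\xi)\,\xi^i\xi^j\,dt .$$ For a smooth scalar function $v$ let $\mathrm{d}^2v=\mathrm{d}(\mathrm{d}v)$, where $\mathrm{d}$ is the inner derivative $(\mathrm{d}u)_{i_1\dots i_{m+1}}=\sigma(i_1,\dots,i_{m+1})\big(\partial u_{i_1\dots i_m}/\partial x_{i_{m+1}}\big)$ and $\sigma$ is symmetrization (the average over all permutations of the indices); thus $(\mathrm{d}^2 v)_{ij}=\partial_i\partial_j v$. Then: 1. $I^0f=0$ and $I^1f=0$ on $T\mathbb{S}^1$ if and only if there is a smooth function $v:\mathbb{R}^2\to\mathbb{R}$ with $v(x)\to 0$ as $|x|\to\infty$ and $f=\mathrm{d}^2 v$ on $\mathbb{R}^2$.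 2. If $I^0f=0$ on $T\mathbb{S}^1$, then $\int_{\mathbb{R}^2} f_{ij}(x)\,dx=0$ for all $i,j\in\{1,2\}$. -/

import Mathlib

open scoped SchwartzMap ContDiff Topology

noncomputable section

namespace MomentumRay

/-- The Euclidean space `ℝⁿ`. -/
abbrev E (n : ℕ) : Type := EuclideanSpace ℝ (Fin n)

/-- An `m`-tensor on `ℝⁿ`, through its Cartesian components `u_{i₁…iₘ}`. -/
abbrev Tensor (n m : ℕ) : Type := (Fin m → Fin n) → ℝ

/-- An `m`-tensor field on `ℝⁿ`, `u x I = u_I(x)`. -/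
abbrev TensorField (n m : ℕ) : Type := E n → Tensor n m

/-- The symmetrization `σ` over all `m` indices. -/
def symmetrize {n m : ℕ} (u : Tensor n m) : Tensor n m :=
  fun I => ((m.factorial : ℝ))⁻¹ * ∑ π : Equiv.Perm (Fin m), u (I ∘ π)

/-- The partial derivative `∂h/∂xᵢ` of a scalar function. -/
def partialDeriv {n : ℕ} (i : Fin n) (h : E n → ℝ) (x : E n) : ℝ :=
  fderiv ℝ h x (EuclideanSpace.single i 1)

/-- The inner (symmetrized) derivative
`(d u)_{i₁…iₘ₊₁} = σ(i₁,…,iₘ₊₁) (∂u_{i₁…iₘ} / ∂x_{iₘ₊₁})`. -/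
def innerDeriv {n m : ℕ} (u : TensorField n m) : TensorField n (m + 1) :=
  fun x => symmetrize fun I =>
    partialDeriv (I (Fin.last m)) (fun y => u y (fun k => I k.castSucc)) x

/-- A scalar function, regarded as a `0`-tensor field. -/
def scalarField {n : ℕ} (v : E n → ℝ) : TensorField n 0 := fun x _ => v x

/-- The `2`-potential field `d² v = d (d v)` of a scalar function `v`. -/
def dSq {n : ℕ} (v : E n → ℝ) : TensorField n 2 :=
  innerDeriv (m := 1) (innerDeriv (m := 0) (scalarField v))

/-- `𝓢(Sᵐ)`: symmetric `m`-tensor fields on `ℝⁿ` with components in the Schwartz space. -/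
structure SchwartzSymTensorField (n m : ℕ) where
  /-- The Cartesian components. -/
  comp : (Fin m → Fin n) → 𝓢(E n, ℝ)
  /-- The components do not change under permutations of the indices. -/
  symm : ∀ (π : Equiv.Perm (Fin m)) (I : Fin m → Fin n), comp (I ∘ π) = comp I

/-- The underlying tensor field. -/
def SchwartzSymTensorField.toField {n m : ℕ} (f : SchwartzSymTensorField n m) :
    TensorField n m :=
  fun x I => f.comp I x

/-- `T𝕊ⁿ⁻¹ = {(x, ξ) : |ξ| = 1, ⟨x, ξ⟩ = 0}`, the manifold of oriented lines in `ℝⁿ`. -/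
def TSphere (n : ℕ) : Type := {p : E n × E n // ‖p.2‖ = 1 ∧ inner ℝ p.1 p.2 = 0}

/-- The `q`-th integral moment (momentum ray) transform
`I^q f (x, ξ) = ∫ t^q f_{ij}(x + t ξ) ξ^i ξ^j dt` on `T𝕊ⁿ⁻¹`. -/
def momentTransform {n : ℕ} (q : ℕ) (f : SchwartzSymTensorField n 2) : TSphere n → ℝ :=
  fun p => ∫ t : ℝ, t ^ q *
    ∑ i : Fin n, ∑ j : Fin n, f.toField (p.1.1 + t • p.1.2) ![i, j] * p.1.2 i * p.1.2 j

end MomentumRay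

end

/-!
The equivalence rests on three observations; the vanishing of the means follows from Fubini alone.

*Potential fields.* If `f = d²v` with `v → 0` at infinity, then along the line `t ↦ x + tξ` the
function `φ(t) = v(x + tξ)` satisfies `φ'' = f_{ij} ξ^i ξ^j`. Since `t φ' - φ` is a primitive of the
integrable function `t φ''`, it has limits at `±∞`; as `φ → 0`, the mean value theorem on `[t, 2t]`
forces `t φ' → 0`, so that both `∫ φ''` and `∫ t φ''` vanish (`integral_moments_eq_zero`).

*Closedness.* Write `F_{ij}` for the Fourier transform of `f_{ij}` and `ξ^⊥` for `ξ` rotated by a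
right angle. Integrating over the lines in the direction `ξ` first shows that `I⁰f = 0` gives
`F_{ij}(y) ξ^i ξ^j = 0` for `y ∈ ℝ ξ^⊥`, while `I¹f = 0` gives `∂_ξ F_{ij}(y) ξ^i ξ^j = 0` there. The
first identity, with `ξ` expressed through `y`, holds identically in `y`; its derivative in the
direction `ξ` combined with the second one gives `F_{ij}(y) ξ^i = 0` for both `j`
(`fourier_contract_eq_zero`). This is the Fourier image of `∂_k f_{ij} = ∂_i f_{kj}`
(`closed_of_moments`).

*The potential.* For closed `f` the function `v(x) = ∫₀^∞ s f₁₁(x + s e₁) ds` is smooth, and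
integration by parts in `s` gives `∂_j ∂_i v = f_{ij}` (`partialDeriv_partialDeriv_rayMoment`). It
decays when `x₁ ≥ 0`, since then `|x + s e₁| ≥ max(|x|, s)`. When `x₁ ≤ 0`, the vanishing of the first
moment over the whole line allows the ray to be replaced by the opposite one
(`tendsto_rayMoment_cocompact`).

The means: `∫ f_{ij} ξ^i ξ^j dx` is an integral over parallel lines of values of `I⁰f`, hence
vanishes for every unit vector `ξ`, and a quadratic form is determined by its values there.
-/

namespace MomentumRay

open MeasureTheory Filter Set LineDeriv FourierTransform

universe u

/-! ### Moments of a second derivative on the line -/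

lemma hasDerivAt_mul_deriv_sub {φ φ' φ'' : ℝ → ℝ} {t : ℝ} (h1 : HasDerivAt φ (φ' t) t)
    (h2 : HasDerivAt φ' (φ'' t) t) :
    HasDerivAt (fun t => t * φ' t - φ t) (t * φ'' t) t :=
  (((hasDerivAt_id t).mul h2).sub h1).congr_deriv (by simp)

/-- If `φ → 0` and `t φ''` is integrable, then `t φ' → 0`: the primitive `t φ' - φ` of `t φ''` has a
limit, and this limit vanishes by the mean value theorem on the intervals `[t, 2t]`. -/
lemma tendsto_mul_deriv_atTop {φ φ' φ'' : ℝ → ℝ} (h1 : ∀ t, HasDerivAt φ (φ' t) t)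
    (h2 : ∀ t, HasDerivAt φ' (φ'' t) t) (hφ : Tendsto φ atTop (𝓝 0))
    (hi : Integrable fun t => t * φ'' t) :
    Tendsto (fun t => t * φ' t) atTop (𝓝 0) := by
  have hψ := fun t => hasDerivAt_mul_deriv_sub (h1 t) (h2 t)
  obtain ⟨L, hL⟩ : ∃ L, Tendsto (fun t => t * φ' t - φ t) atTop (𝓝 L) :=
    ⟨_, tendsto_limUnder_of_hasDerivAt_of_integrableOn_Ioi (a := 0) (fun x _ => hψ x)
      hi.integrableOn⟩
  have hL' : Tendsto (fun t => t * φ' t) atTop (𝓝 L) := by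
    simpa using hL.add hφ
  have hex : ∀ t : ℝ, ∃ c : ℝ, 0 < t → t < c ∧ c < 2 * t ∧ t * φ' c = φ (2 * t) - φ t := by
    intro t
    by_cases ht : 0 < t
    · obtain ⟨c, hc, h⟩ := exists_hasDerivAt_eq_slope φ φ' (by linarith : t < 2 * t)
        (fun x _ => (h1 x).continuousAt.continuousWithinAt) (fun x _ => h1 x)
      refine ⟨c, fun _ => ⟨hc.1, hc.2, ?_⟩⟩
      rw [h]
      field_simp
      ring
    · exact ⟨0, fun h => absurd h ht⟩
  -- The mean value points `c t ∈ (t, 2t)` tend to infinity, and `c φ'(c)` tends to `0` along them.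
  choose c hc using hex
  have hcT : Tendsto c atTop atTop := by
    refine tendsto_atTop_mono' _ ?_ tendsto_id
    filter_upwards [eventually_gt_atTop 0] with t ht using (hc t ht).1.le
  have hdiff : Tendsto (fun t => 2 * |φ (2 * t) - φ t|) atTop (𝓝 0) := by
    have : Tendsto (fun t : ℝ => φ (2 * t)) atTop (𝓝 0) :=
      hφ.comp (tendsto_id.const_mul_atTop (by norm_num))
    simpa using (this.sub hφ).abs.const_mul 2
  have hz : Tendsto (fun t => c t * φ' (c t)) atTop (𝓝 0) := by
    refine squeeze_zero_norm' ?_ hdiff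
    filter_upwards [eventually_gt_atTop 0] with t ht
    obtain ⟨h1, h2, h3⟩ := hc t ht
    rw [← h3, Real.norm_eq_abs, abs_mul, abs_mul, abs_of_pos ht, abs_of_pos (ht.trans h1),
      ← mul_assoc]
    gcongr
  have := tendsto_nhds_unique (hL'.comp hcT) hz
  rwa [this] at hL'

lemma tendsto_deriv_atTop {φ' : ℝ → ℝ} (h : Tendsto (fun t => t * φ' t) atTop (𝓝 0)) :
    Tendsto φ' atTop (𝓝 0) := by
  have := h.mul tendsto_inv_atTop_zero
  rw [mul_zero] at this
  refine this.congr' ?_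
  filter_upwards [eventually_gt_atTop 0] with t ht
  field_simp

lemma integral_moments_eq_zero {φ φ' φ'' : ℝ → ℝ} (h1 : ∀ t, HasDerivAt φ (φ' t) t)
    (h2 : ∀ t, HasDerivAt φ' (φ'' t) t) (htop : Tendsto φ atTop (𝓝 0))
    (hbot : Tendsto φ atBot (𝓝 0))
    (hi0 : Integrable φ'') (hi : Integrable fun t => t * φ'' t) :
    ∫ t, φ'' t = 0 ∧ ∫ t, t * φ'' t = 0 := by
  have hψ := fun t => hasDerivAt_mul_deriv_sub (h1 t) (h2 t)
  have ht := tendsto_mul_deriv_atTop h1 h2 htop hi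
  -- The behaviour at `-∞` is that of `t ↦ φ (-t)` at `+∞`.
  have hb : Tendsto (fun t => t * -φ' (-t)) atTop (𝓝 0) := by
    refine tendsto_mul_deriv_atTop (φ := fun t => φ (-t)) (φ'' := fun t => φ'' (-t)) ?_ ?_
      (hbot.comp tendsto_neg_atTop_atBot) ?_
    · intro t
      exact ((h1 (-t)).comp t (hasDerivAt_neg t)).congr_deriv (by simp)
    · intro t
      exact ((h2 (-t)).comp t (hasDerivAt_neg t)).neg.congr_deriv (by simp)
    · simpa using hi.comp_neg.neg
  have ht' := tendsto_deriv_atTop ht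
  have hb' : Tendsto φ' atBot (𝓝 0) := by
    have := ((tendsto_deriv_atTop hb).neg).comp tendsto_neg_atBot_atTop
    simpa [Function.comp_def] using this
  have hb : Tendsto (fun t => t * φ' t) atBot (𝓝 0) := by
    have := hb.comp tendsto_neg_atBot_atTop
    simpa [Function.comp_def] using this
  constructor
  · simpa using integral_of_hasDerivAt_of_tendsto h2 hi0 hb' ht'
  · simpa using integral_of_hasDerivAt_of_tendsto hψ hi (hb.sub hbot) (ht.sub htop)

section Ray

/-! ### Moments of Schwartz functions along lines and rays -/

variable {V F : Type u} [NormedAddCommGroup V] [InnerProductSpace ℝ V]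
  [NormedAddCommGroup F] [NormedSpace ℝ F]

lemma exists_decay (h : 𝓢(V, F)) (k : ℕ) :
    ∃ C, 0 ≤ C ∧ ∀ x, ‖h x‖ ≤ C * ((1 + ‖x‖) ^ k)⁻¹ := by
  refine ⟨2 ^ k * (Finset.Iic (k, 0)).sup (fun m => SchwartzMap.seminorm ℝ m.1 m.2) h,
    by positivity, fun x => ?_⟩
  have := SchwartzMap.one_add_le_sup_seminorm_apply (𝕜 := ℝ) (m := (k, 0)) le_rfl le_rfl h x
  rw [norm_iteratedFDeriv_zero] at this
  rw [← div_eq_mul_inv, le_div_iff₀ (by positivity), mul_comm]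
  exact this

lemma integrable_inv_one_add_abs_sq : Integrable fun t : ℝ => ((1 + |t|) ^ 2)⁻¹ := by
  have := integrable_one_add_norm (E := ℝ) (μ := volume) (r := 2) (by simp)
  refine this.congr (ae_of_all _ fun t => ?_)
  simp only [Real.norm_eq_abs]
  rw [Real.rpow_neg (by positivity)]
  norm_cast

lemma pow_mul_inv_pow_le (q : ℕ) (t : ℝ) :
    |t| ^ q * ((1 + |t|) ^ (q + 2))⁻¹ ≤ ((1 + |t|) ^ 2)⁻¹ := by
  rw [← div_eq_mul_inv, div_le_iff₀ (by positivity), pow_add, mul_comm (_ ^ q), ← mul_assoc,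
    inv_mul_cancel₀ (by positivity), one_mul]
  gcongr
  linarith

/-- A bound along lines that is integrable in `t` and locally uniform in the base point `x`; it follows
from `1 + |t| ≤ (1 + ‖x‖) (1 + ‖x + t e‖)`. -/
lemma exists_line_bound (h : 𝓢(V, F)) {e : V} (he : ‖e‖ = 1) (q : ℕ) :
    ∃ C, 0 ≤ C ∧ ∀ x t, ‖t ^ q • h (x + t • e)‖ ≤ C * (1 + ‖x‖) ^ (q + 2) * ((1 + |t|) ^ 2)⁻¹ := by
  obtain ⟨C, hC, hb⟩ := exists_decay h (q + 2)
  refine ⟨C, hC, fun x t => ?_⟩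
  have ht : |t| ≤ ‖x + t • e‖ + ‖x‖ := by
    have : ‖t • e‖ ≤ ‖x + t • e‖ + ‖x‖ := by
      calc ‖t • e‖ = ‖(x + t • e) - x‖ := by simp
        _ ≤ _ := norm_sub_le _ _
    simpa [norm_smul, he] using this
  have hprod : 1 + |t| ≤ (1 + ‖x‖) * (1 + ‖x + t • e‖) := by
    nlinarith [norm_nonneg x, norm_nonneg (x + t • e)]
  have hinv : ((1 + ‖x + t • e‖) ^ (q + 2))⁻¹ ≤ (1 + ‖x‖) ^ (q + 2) * ((1 + |t|) ^ (q + 2))⁻¹ := by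
    rw [← div_eq_mul_inv, le_div_iff₀ (by positivity), inv_mul_le_iff₀ (by positivity), ← mul_pow,
      mul_comm]
    gcongr
  calc ‖t ^ q • h (x + t • e)‖ = |t| ^ q * ‖h (x + t • e)‖ := by
        rw [norm_smul, norm_pow, Real.norm_eq_abs]
    _ ≤ |t| ^ q * (C * ((1 + ‖x‖) ^ (q + 2) * ((1 + |t|) ^ (q + 2))⁻¹)) := by
        gcongr
        exact (hb _).trans (by gcongr)
    _ = C * (1 + ‖x‖) ^ (q + 2) * (|t| ^ q * ((1 + |t|) ^ (q + 2))⁻¹) := by ring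
    _ ≤ _ := by
        gcongr
        exact pow_mul_inv_pow_le q t

lemma continuous_line (h : 𝓢(V, F)) (e : V) (q : ℕ) (x : V) :
    Continuous fun t : ℝ => t ^ q • h (x + t • e) := by
  have := h.continuous
  fun_prop

lemma integrable_line (h : 𝓢(V, F)) {e : V} (he : ‖e‖ = 1) (q : ℕ) (x : V) :
    Integrable fun t : ℝ => t ^ q • h (x + t • e) := by
  obtain ⟨C, hC, hb⟩ := exists_line_bound h he q
  exact (integrable_inv_one_add_abs_sq.const_mul (C * (1 + ‖x‖) ^ (q + 2))).mono'
    (continuous_line h e q x).aestronglyMeasurable (ae_of_all _ fun t => hb x t)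

/-- The `q`-th moment of `h` along the ray issuing from `x` in the direction `e`. -/
noncomputable def rayMoment (q : ℕ) (e : V) (h : 𝓢(V, F)) (x : V) : F :=
  ∫ t in Ioi (0 : ℝ), t ^ q • h (x + t • e)

lemma hasFDerivAt_rayMoment (q : ℕ) {e : V} (he : ‖e‖ = 1) (h : 𝓢(V, F)) (x : V) :
    HasFDerivAt (rayMoment q e h) (rayMoment q e (SchwartzMap.fderivCLM ℝ V F h) x) x := by
  obtain ⟨C, hC, hb⟩ := exists_line_bound (SchwartzMap.fderivCLM ℝ V F h) he q
  refine hasFDerivAt_integral_of_dominated_of_fderiv_le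
    (F := fun x t => t ^ q • h (x + t • e))
    (F' := fun x t => t ^ q • SchwartzMap.fderivCLM ℝ V F h (x + t • e))
    (bound := fun t => C * (2 + ‖x‖) ^ (q + 2) * ((1 + |t|) ^ 2)⁻¹)
    (Metric.ball_mem_nhds x one_pos) ?_ ?_ ?_ ?_ ?_ ?_
  · exact Eventually.of_forall fun y => (continuous_line h e q y).aestronglyMeasurable
  · exact (integrable_line h he q x).integrableOn
  · exact (integrable_line (SchwartzMap.fderivCLM ℝ V F h) he q x).aestronglyMeasurable.restrict
  · refine ae_of_all _ fun t y hy => (hb y t).trans ?_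
    have : ‖y‖ ≤ 1 + ‖x‖ := by
      have := norm_sub_norm_le y x
      rw [Metric.mem_ball, dist_eq_norm] at hy
      linarith
    gcongr ?_ * ?_ ^ _ * _
    linarith
  · exact (integrable_inv_one_add_abs_sq.const_mul _).integrableOn
  · refine ae_of_all _ fun t y _ => ?_
    have h1 := (h.hasFDerivAt (y + t • e)).comp y ((hasFDerivAt_id y).add_const (t • e))
    exact h1.const_smul (t ^ q)

lemma contDiff_rayMoment (q : ℕ) {e : V} (he : ‖e‖ = 1) (h : 𝓢(V, F)) :
    ContDiff ℝ ∞ (rayMoment q e h) := by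
  rw [contDiff_infty]
  intro n
  induction n generalizing F with
  | zero =>
    exact contDiff_zero.2 (continuous_iff_continuousAt.2
      fun x => (hasFDerivAt_rayMoment q he h x).continuousAt)
  | succ n ih =>
    push_cast
    rw [contDiff_succ_iff_hasFDerivAt]
    exact ⟨_, ih (SchwartzMap.fderivCLM ℝ V F h), hasFDerivAt_rayMoment q he h⟩

lemma hasDerivAt_line (h : 𝓢(V, F)) (x e : V) (t : ℝ) :
    HasDerivAt (fun t : ℝ => h (x + t • e)) (∂_{e} h (x + t • e)) t := by
  have hl : HasDerivAt (fun t : ℝ => x + t • e) e t := by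
    simpa using ((hasDerivAt_id t).smul_const e).const_add x
  exact (h.hasFDerivAt (x + t • e)).comp_hasDerivAt t hl

lemma fderiv_rayMoment_apply [CompleteSpace F] (q : ℕ) {e : V} (he : ‖e‖ = 1) (h : 𝓢(V, F))
    (x m : V) :
    fderiv ℝ (rayMoment q e h) x m = rayMoment q e (∂_{m} h) x := by
  rw [(hasFDerivAt_rayMoment q he h x).fderiv, rayMoment,
    ContinuousLinearMap.integral_apply (integrable_line (SchwartzMap.fderivCLM ℝ V F h) he q x).integrableOn]
  rfl

lemma tendsto_line_atTop (h : 𝓢(V, F)) {e : V} (he : ‖e‖ = 1) (q : ℕ) (x : V) :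
    Tendsto (fun t : ℝ => t ^ q • h (x + t • e)) atTop (𝓝 0) := by
  obtain ⟨C, hC, hb⟩ := exists_line_bound h he q
  refine squeeze_zero_norm (hb x) ?_
  rw [← mul_zero (C * (1 + ‖x‖) ^ (q + 2))]
  refine Tendsto.const_mul _ (Tendsto.inv_tendsto_atTop ?_)
  exact (tendsto_pow_atTop two_ne_zero).comp (tendsto_atTop_add_const_left _ 1 tendsto_abs_atTop_atTop)

lemma rayMoment_zero_lineDeriv [CompleteSpace F] {e : V} (he : ‖e‖ = 1) (h : 𝓢(V, F)) (x : V) :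
    rayMoment 0 e (∂_{e} h) x = - h x := by
  have hi := integrable_line (∂_{e} h) he 0 x
  have ht := tendsto_line_atTop h he 0 x
  simp only [rayMoment, pow_zero, one_smul] at hi ht ⊢
  rw [integral_Ioi_of_hasDerivAt_of_tendsto' (fun t _ => hasDerivAt_line h x e t)
    hi.integrableOn ht]
  simp

lemma rayMoment_one_lineDeriv [CompleteSpace F] {e : V} (he : ‖e‖ = 1) (h : 𝓢(V, F)) (x : V) :
    rayMoment 1 e (∂_{e} h) x = - rayMoment 0 e h x := by
  have hi := integrable_line (∂_{e} h) he 1 x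
  have hi0 := integrable_line h he 0 x
  have ht := tendsto_line_atTop h he 1 x
  simp only [rayMoment, pow_zero, one_smul, pow_one] at hi hi0 ht ⊢
  have hd : ∀ t : ℝ, HasDerivAt (fun t : ℝ => t • h (x + t • e))
      (t • ∂_{e} h (x + t • e) + h (x + t • e)) t := fun t => by
    exact ((hasDerivAt_id t).smul (hasDerivAt_line h x e t)).congr_deriv (by simp)
  have := integral_Ioi_of_hasDerivAt_of_tendsto' (a := 0) (fun t _ => hd t)
    (hi.add hi0).integrableOn ht
  rw [integral_add hi.integrableOn hi0.integrableOn] at this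
  rw [eq_neg_iff_add_eq_zero, this]
  simp

/-- If the first moment of `h` over a whole line vanishes, the moments over its two opposite rays agree
(the parameter of the opposite ray has the opposite sign). -/
lemma rayMoment_one_eq_opposite {e : V} (he : ‖e‖ = 1) (h : 𝓢(V, F)) (x : V)
    (hz : ∫ t : ℝ, t • h (x + t • e) = 0) :
    rayMoment 1 e h x = rayMoment 1 (-e) h x := by
  have hi := integrable_line h he 1 x
  simp only [pow_one] at hi
  have h1 := integral_comp_neg_Ioi (c := 0) (fun t : ℝ => t • h (x + t • e))
  rw [← setIntegral_univ, ← Set.Iic_union_Ioi (a := (0 : ℝ)),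
    setIntegral_union (Iic_disjoint_Ioi le_rfl) measurableSet_Ioi hi.integrableOn hi.integrableOn,
    ← neg_zero, ← h1, neg_zero] at hz
  simp only [rayMoment, pow_one, smul_neg]
  simp only [neg_smul, integral_neg] at hz
  exact (neg_add_eq_zero.1 hz).symm

/-- The first moment decays on the half-space `⟨x, e⟩ ≥ 0`, because `‖x + t e‖ ≥ max ‖x‖ t` there. -/
lemma exists_norm_rayMoment_le (h : 𝓢(V, F)) : ∃ C, ∀ e : V, ‖e‖ = 1 → ∀ x : V,
    0 ≤ inner ℝ x e → ‖rayMoment 1 e h x‖ ≤ C * (1 + ‖x‖)⁻¹ := by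
  -- Four powers of decay: one is spent on `‖x‖`, one on the factor `t`, two on integrability.
  obtain ⟨C, hC, hb⟩ := exists_decay h 4
  refine ⟨C * ∫ t in Ioi (0 : ℝ), ((1 + |t|) ^ 2)⁻¹, fun e he x hx => ?_⟩
  have hpt : ∀ t ∈ Ioi (0 : ℝ), ‖t ^ 1 • h (x + t • e)‖ ≤
      C * (1 + ‖x‖)⁻¹ * ((1 + |t|) ^ 2)⁻¹ := by
    intro t ht
    have ht : 0 < t := ht
    have hsq : ‖x + t • e‖ ^ 2 = ‖x‖ ^ 2 + 2 * (t * inner ℝ x e) + t ^ 2 := by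
      rw [norm_add_sq_real, inner_smul_right, norm_smul, he]
      simp
    have hmul : 0 ≤ t * inner ℝ x e := by positivity
    have h1 : ‖x‖ ≤ ‖x + t • e‖ :=
      le_of_sq_le_sq (by nlinarith) (norm_nonneg _)
    have h2 : t ≤ ‖x + t • e‖ :=
      le_of_sq_le_sq (by nlinarith [sq_nonneg ‖x‖]) (norm_nonneg _)
    have h3 : ((1 + ‖x + t • e‖) ^ 4)⁻¹ ≤ (1 + ‖x‖)⁻¹ * ((1 + |t|) ^ (1 + 2))⁻¹ := by
      rw [← mul_inv]
      gcongr
      calc (1 + ‖x‖) * (1 + |t|) ^ (1 + 2)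
          ≤ (1 + ‖x + t • e‖) * (1 + ‖x + t • e‖) ^ (1 + 2) := by
            rw [abs_of_pos ht]
            gcongr
        _ = (1 + ‖x + t • e‖) ^ 4 := by ring
    calc ‖t ^ 1 • h (x + t • e)‖ = |t| ^ 1 * ‖h (x + t • e)‖ := by
          rw [norm_smul, norm_pow, Real.norm_eq_abs]
      _ ≤ |t| ^ 1 * (C * ((1 + ‖x‖)⁻¹ * ((1 + |t|) ^ (1 + 2))⁻¹)) := by
          gcongr
          exact (hb _).trans (by gcongr)
      _ = C * (1 + ‖x‖)⁻¹ * (|t| ^ 1 * ((1 + |t|) ^ (1 + 2))⁻¹) := by ring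
      _ ≤ _ := by
          gcongr
          exact pow_mul_inv_pow_le 1 t
  calc ‖rayMoment 1 e h x‖ ≤ ∫ t in Ioi (0 : ℝ), C * (1 + ‖x‖)⁻¹ * ((1 + |t|) ^ 2)⁻¹ :=
        norm_integral_le_of_norm_le (integrable_inv_one_add_abs_sq.const_mul _).integrableOn
          ((ae_restrict_iff' measurableSet_Ioi).2 (ae_of_all _ hpt))
    _ = _ := by
        rw [integral_const_mul]
        ring

end Ray

/-! ### The moment transform and the associated quadratic form -/

/-- The Schwartz function `x ↦ ∑ f_{ij}(x) ξ^i ξ^j`. -/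
noncomputable def SchwartzSymTensorField.quad {n : ℕ} (f : SchwartzSymTensorField n 2) (ξ : E n) :
    𝓢(E n, ℝ) :=
  ∑ i, ∑ j, (ξ i * ξ j) • f.comp ![i, j]

lemma SchwartzSymTensorField.quad_apply {n : ℕ} (f : SchwartzSymTensorField n 2) (ξ x : E n) :
    f.quad ξ x = ∑ i, ∑ j, f.toField x ![i, j] * ξ i * ξ j := by
  simp only [quad, sum_apply, smul_apply, toField, smul_eq_mul]
  refine Finset.sum_congr rfl fun i _ => Finset.sum_congr rfl fun j _ => ?_
  ring

lemma integral_line_quad {n : ℕ} {q : ℕ} {f : SchwartzSymTensorField n 2}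
    (h : momentTransform q f = 0) {x ξ : E n} (hξ : ‖ξ‖ = 1) (hx : inner ℝ x ξ = 0) :
    ∫ t : ℝ, t ^ q * f.quad ξ (x + t • ξ) = 0 := by
  simp only [SchwartzSymTensorField.quad_apply]
  exact congrFun h ⟨(x, ξ), hξ, hx⟩

/-- The base point of a line need not be orthogonal to its direction: moving it along the line changes
the first moment by a multiple of the zeroth. -/
lemma integral_mul_line_quad {n : ℕ} {f : SchwartzSymTensorField n 2}
    (h0 : momentTransform 0 f = 0) (h1 : momentTransform 1 f = 0) (x : E n) {ξ : E n}
    (hξ : ‖ξ‖ = 1) :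
    ∫ t : ℝ, t • f.quad ξ (x + t • ξ) = 0 := by
  set a : ℝ := inner ℝ x ξ
  have hx : inner ℝ (x - a • ξ) ξ = 0 := by
    rw [inner_sub_left, inner_smul_left, real_inner_self_eq_norm_sq, hξ]
    simp [a]
  have e0 := integral_line_quad h0 hξ hx
  have e1 := integral_line_quad h1 hξ hx
  have i0 := integrable_line (f.quad ξ) hξ 0 (x - a • ξ)
  have i1 := integrable_line (f.quad ξ) hξ 1 (x - a • ξ)
  simp only [pow_zero, pow_one, one_mul, smul_eq_mul] at e0 e1 i0 i1 ⊢
  rw [← integral_sub_right_eq_self _ a]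
  calc _ = ∫ t : ℝ, (t * f.quad ξ (x - a • ξ + t • ξ) - a * f.quad ξ (x - a • ξ + t • ξ)) := by
        refine integral_congr_ae (ae_of_all _ fun t => ?_)
        have : x + (t - a) • ξ = x - a • ξ + t • ξ := by
          rw [sub_smul]
          abel
        simp only [this]
        ring
    _ = 0 := by
        rw [integral_sub i1 (i0.const_mul a), integral_const_mul, e0, e1]
        simp

/-! ### Plane geometry and integration over parallel lines -/

/-- Rotation of the plane by a right angle. -/
def perp (ξ : E 2) : E 2 := !₂[-ξ 1, ξ 0]

@[simp] lemma perp_zero (ξ : E 2) : perp ξ 0 = -ξ 1 := rfl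

@[simp] lemma perp_one (ξ : E 2) : perp ξ 1 = ξ 0 := rfl

lemma inner_eq (x y : E 2) : inner ℝ x y = x 0 * y 0 + x 1 * y 1 := by
  simp [PiLp.inner_apply, Fin.sum_univ_two, mul_comm]

lemma norm_sq_eq (x : E 2) : ‖x‖ ^ 2 = x 0 ^ 2 + x 1 ^ 2 := by
  rw [← real_inner_self_eq_norm_sq, inner_eq]
  ring

lemma inner_perp (ξ : E 2) : inner ℝ (perp ξ) ξ = 0 := by
  rw [inner_eq, perp_zero, perp_one]
  ring

lemma norm_perp (ξ : E 2) : ‖perp ξ‖ = ‖ξ‖ := by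
  rw [← sq_eq_sq₀ (norm_nonneg _) (norm_nonneg _), norm_sq_eq, norm_sq_eq, perp_zero, perp_one]
  ring

lemma exists_eq_smul_perp (y : E 2) : ∃ (ξ : E 2) (r : ℝ), ‖ξ‖ = 1 ∧ y = r • perp ξ := by
  by_cases hy : y = 0
  · exact ⟨EuclideanSpace.single 0 1, 0, by simp, by simp [hy]⟩
  · have hn : ‖y‖ ≠ 0 := norm_ne_zero_iff.2 hy
    refine ⟨-(‖y‖⁻¹ • perp y), ‖y‖, ?_, ?_⟩
    · rw [norm_neg, norm_smul, norm_perp, norm_inv, norm_norm, inv_mul_cancel₀ hn]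
    · ext i
      fin_cases i <;> simp [hn]

/-- Fubini's theorem in the orthonormal frame `(ξ^⊥, ξ)`. -/
lemma integral_eq_integral_lines {G : Type*} [NormedAddCommGroup G] [NormedSpace ℝ G] {ξ : E 2}
    (hξ : ‖ξ‖ = 1) {h : E 2 → G} (hi : Integrable h) :
    ∫ x, h x = ∫ s : ℝ, ∫ t : ℝ, h (s • perp ξ + t • ξ) := by
  have hon : Orthonormal ℝ ![perp ξ, ξ] := by
    rw [orthonormal_iff_ite]
    intro i j
    have hp : ‖perp ξ‖ = 1 := by rw [norm_perp, hξ]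
    fin_cases i <;> fin_cases j <;>
      simp [hξ, hp, inner_perp, real_inner_comm (perp ξ) ξ]
  let B := (basisOfOrthonormalOfCardEqFinrank hon (by simp)).toOrthonormalBasis
    (by simpa using hon)
  have hB0 : B 0 = perp ξ := by simp [B]
  have hB1 : B 1 = ξ := by simp [B]
  have hmp : MeasurePreserving (fun p : ℝ × ℝ => p.1 • perp ξ + p.2 • ξ) := by
    have := B.measurePreserving_repr_symm.comp ((PiLp.volume_preserving_toLp (Fin 2)).comp
      (volume_preserving_finTwoArrow ℝ).symm)
    have heq : (fun p : ℝ × ℝ => p.1 • perp ξ + p.2 • ξ) = B.repr.symm ∘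
        (WithLp.toLp 2 ∘ (MeasurableEquiv.finTwoArrow : (Fin 2 → ℝ) ≃ᵐ ℝ × ℝ).symm) := by
      ext1 p
      change _ = B.repr.symm (WithLp.toLp 2 ![p.1, p.2])
      rw [← OrthonormalBasis.sum_repr_symm, Fin.sum_univ_two, hB0, hB1]
      simp
    rw [heq]
    exact this
  have hm : AEStronglyMeasurable h
      (Measure.map (fun p : ℝ × ℝ => p.1 • perp ξ + p.2 • ξ) volume) := by
    rw [hmp.map_eq]
    exact hi.aestronglyMeasurable
  rw [← hmp.map_eq, integral_map hmp.measurable.aemeasurable hm]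
  exact integral_prod _ (hmp.integrable_comp_of_integrable hi)

/-! ### The Fourier transform of the tensor field -/

/-- A real Schwartz function, regarded as complex-valued. -/
noncomputable def complexify {n : ℕ} (g : 𝓢(E n, ℝ)) : 𝓢(E n, ℂ) :=
  SchwartzMap.postcompCLM Complex.ofRealCLM g

@[simp] lemma complexify_apply {n : ℕ} (g : 𝓢(E n, ℝ)) (x : E n) : complexify g x = g x := rfl

/-- Fourier slice: if `g` integrates to zero over every line in the direction `ξ`, its Fourier
transform vanishes on `ℝ ξ^⊥`, since the character is constant on these lines. -/
lemma fourier_eq_zero_of_lines {g : 𝓢(E 2, ℝ)} {ξ : E 2} (hξ : ‖ξ‖ = 1)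
    (h : ∀ s : ℝ, ∫ t : ℝ, g (s • perp ξ + t • ξ) = 0) (r : ℝ) :
    𝓕 (complexify g) (r • perp ξ) = 0 := by
  have hi : Integrable fun x => Real.fourierChar (-inner ℝ x (r • perp ξ)) • complexify g x :=
    (Real.fourierIntegral_convergent_iff _).2 (complexify g).integrable
  rw [SchwartzMap.fourier_coe, Real.fourier_eq, integral_eq_integral_lines hξ hi]
  refine integral_eq_zero_of_ae (ae_of_all _ fun s => ?_)
  have hin : ∀ t : ℝ, inner ℝ (s • perp ξ + t • ξ) (r • perp ξ) = s * r := fun t => by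
    rw [inner_add_left, inner_smul_left, inner_smul_right, inner_smul_left, inner_smul_right,
      real_inner_comm (perp ξ) ξ, inner_perp, real_inner_self_eq_norm_sq, norm_perp, hξ]
    simp
  simp only [hin, complexify_apply, Circle.smul_def, integral_smul, integral_complex_ofReal, h]
  simp

lemma SchwartzSymTensorField.comp_swap {n : ℕ} (f : SchwartzSymTensorField n 2) (i j : Fin n) :
    f.comp ![i, j] = f.comp ![j, i] := by
  rw [← f.symm (Equiv.swap 0 1) ![j, i]]
  congr 1
  ext k
  fin_cases k <;> simp

lemma SchwartzSymTensorField.quad_apply_two (f : SchwartzSymTensorField 2 2) (ξ x : E 2) :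
    f.quad ξ x = ξ 0 ^ 2 * f.comp ![0, 0] x + 2 * ξ 0 * ξ 1 * f.comp ![0, 1] x +
      ξ 1 ^ 2 * f.comp ![1, 1] x := by
  simp only [quad_apply, Fin.sum_univ_two, toField, f.comp_swap 1 0]
  ring

lemma complexify_lineDeriv {n : ℕ} (g : 𝓢(E n, ℝ)) (m : E n) :
    complexify (∂_{m} g) = ∂_{m} (complexify g) := by
  ext x
  rw [SchwartzMap.lineDerivOp_apply_eq_fderiv]
  have := (Complex.ofRealCLM.hasFDerivAt.comp x (g.hasFDerivAt x)).fderiv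
  change _ = fderiv ℝ (Complex.ofRealCLM ∘ g) x m
  rw [this]
  rfl

lemma fourier_complexify_lineDeriv {n : ℕ} (g : 𝓢(E n, ℝ)) (m y : E n) :
    𝓕 (complexify (∂_{m} g)) y =
      2 * Real.pi * Complex.I * (inner ℝ y m : ℝ) * 𝓕 (complexify g) y := by
  have : (inner ℝ · m : E n → ℝ).HasTemperateGrowth := ((innerSL ℝ).flip m).hasTemperateGrowth
  rw [complexify_lineDeriv, SchwartzMap.fourier_lineDerivOp_eq, smul_apply,
    SchwartzMap.smulLeftCLM_apply_apply this, smul_eq_mul, Complex.real_smul]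
  ring

lemma complexify_fourier_injective {n : ℕ} {g h : 𝓢(E n, ℝ)}
    (hgh : 𝓕 (complexify g) = 𝓕 (complexify h)) : g = h := by
  have := congrArg (fun u : 𝓢(E n, ℂ) => 𝓕⁻ u) hgh
  simp only [fourierInv_fourier_eq] at this
  ext x
  exact Complex.ofReal_injective (congrArg (fun u : 𝓢(E n, ℂ) => u x) this)

lemma fourier_quad (f : SchwartzSymTensorField 2 2) (ξ : E 2) :
    𝓕 (complexify (f.quad ξ)) =
      ((ξ 0 : ℂ) ^ 2) • 𝓕 (complexify (f.comp ![0, 0])) +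
      (2 * (ξ 0 : ℂ) * ξ 1) • 𝓕 (complexify (f.comp ![0, 1])) +
      ((ξ 1 : ℂ) ^ 2) • 𝓕 (complexify (f.comp ![1, 1])) := by
  rw [← FourierTransform.fourier_smul, ← FourierTransform.fourier_smul,
    ← FourierTransform.fourier_smul, ← FourierTransform.fourier_add,
    ← FourierTransform.fourier_add]
  congr 1
  ext x
  simp [f.quad_apply_two]

lemma fourier_quad_perp {f : SchwartzSymTensorField 2 2} (h0 : momentTransform 0 f = 0) {ξ : E 2}
    (hξ : ‖ξ‖ = 1) (r : ℝ) : 𝓕 (complexify (f.quad ξ)) (r • perp ξ) = 0 := by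
  refine fourier_eq_zero_of_lines hξ (fun s => ?_) r
  simpa using integral_line_quad h0 hξ
    (by rw [inner_smul_left, inner_perp, mul_zero] : inner ℝ (s • perp ξ) ξ = 0)

/-- The factor `t` in `I¹f` is `⟨x, ξ⟩` on the line, and multiplication by `⟨x, ξ⟩` corresponds to the
derivative `∂_ξ` of the Fourier transform. -/
lemma lineDeriv_fourier_quad_perp {f : SchwartzSymTensorField 2 2}
    (h1 : momentTransform 1 f = 0) {ξ : E 2} (hξ : ‖ξ‖ = 1) (r : ℝ) :
    ∂_{ξ} (𝓕 (complexify (f.quad ξ))) (r • perp ξ) = 0 := by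
  have hT : (inner ℝ · ξ : E 2 → ℝ).HasTemperateGrowth := ((innerSL ℝ).flip ξ).hasTemperateGrowth
  have hc : SchwartzMap.smulLeftCLM ℂ (inner ℝ · ξ : E 2 → ℝ) (complexify (f.quad ξ)) =
      complexify (SchwartzMap.smulLeftCLM ℝ (inner ℝ · ξ : E 2 → ℝ) (f.quad ξ)) := by
    ext x
    simp [SchwartzMap.smulLeftCLM_apply_apply hT]
  rw [SchwartzMap.lineDerivOp_fourier_eq, fourier_smul, smul_apply, hc,
    fourier_eq_zero_of_lines hξ, smul_zero]
  intro s
  have hs : inner ℝ (s • perp ξ) ξ = 0 := by rw [inner_smul_left, inner_perp, mul_zero]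
  rw [← integral_line_quad h1 hξ hs]
  refine integral_congr_ae (ae_of_all _ fun t => ?_)
  simp only [SchwartzMap.smulLeftCLM_apply_apply hT]
  rw [inner_add_left, hs, inner_smul_left, real_inner_self_eq_norm_sq, hξ]
  simp

/-- The identity `F_{ij}(y) ξ^i ξ^j = 0` for `y ∈ ℝ ξ^⊥`, with `ξ` expressed through `y`, so that it holds
identically in `y` and may be differentiated. -/
lemma fourier_symbol_eq_zero {f : SchwartzSymTensorField 2 2} (h0 : momentTransform 0 f = 0)
    (y : E 2) :
    𝓕 (complexify (f.comp ![0, 0])) y * (y 1 : ℂ) ^ 2 -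
      2 * 𝓕 (complexify (f.comp ![0, 1])) y * (y 0 * y 1) +
      𝓕 (complexify (f.comp ![1, 1])) y * (y 0 : ℂ) ^ 2 = 0 := by
  obtain ⟨ξ, r, hξ, rfl⟩ := exists_eq_smul_perp y
  have := fourier_quad_perp h0 hξ r
  simp only [fourier_quad, add_apply, smul_apply, smul_eq_mul] at this
  simp only [PiLp.smul_apply, perp_zero, perp_one, smul_eq_mul]
  push_cast
  linear_combination (r : ℂ) ^ 2 * this

/-- `F_{ij}(y) ξ^i = 0` for `y ∈ ℝ ξ^⊥` and each `j`, written in the coordinates of `y`. -/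
lemma fourier_contract_eq_zero {f : SchwartzSymTensorField 2 2} (h0 : momentTransform 0 f = 0)
    (h1 : momentTransform 1 f = 0) (y : E 2) :
    (y 1 : ℂ) * 𝓕 (complexify (f.comp ![0, 0])) y =
        y 0 * 𝓕 (complexify (f.comp ![0, 1])) y ∧
      (y 1 : ℂ) * 𝓕 (complexify (f.comp ![0, 1])) y =
        y 0 * 𝓕 (complexify (f.comp ![1, 1])) y := by
  obtain ⟨ξ, r, hξ, rfl⟩ := exists_eq_smul_perp y
  have e0 := fourier_quad_perp h0 hξ r
  have e1 := lineDeriv_fourier_quad_perp h1 hξ r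
  simp only [fourier_quad, lineDerivOp_add, lineDerivOp_smul, add_apply, smul_apply,
    smul_eq_mul] at e0 e1
  have hsq : (ξ 0 : ℂ) ^ 2 + (ξ 1 : ℂ) ^ 2 = 1 := by
    have := norm_sq_eq ξ
    rw [hξ] at this
    rw [one_pow] at this
    exact_mod_cast this.symm
  have hsym := fun y => fourier_symbol_eq_zero h0 y
  set A := 𝓕 (complexify (f.comp ![0, 0]))
  set B := 𝓕 (complexify (f.comp ![0, 1]))
  set C := 𝓕 (complexify (f.comp ![1, 1]))
  set y := r • perp ξ with hy
  have hd : ∀ D : 𝓢(E 2, ℂ), HasDerivAt (fun s : ℝ => D (y + s • ξ)) (∂_{ξ} D y) 0 := fun D => by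
    simpa using hasDerivAt_line D y ξ 0
  have hl : ∀ i, HasDerivAt (fun s : ℝ => (((y + s • ξ) i : ℝ) : ℂ)) (ξ i : ℂ) 0 := fun i => by
    have h : HasDerivAt (fun s : ℝ => (y + s • ξ) i) (ξ i) 0 := by
      simpa using ((hasDerivAt_id (0 : ℝ)).mul_const (ξ i)).const_add (y i)
    exact h.ofReal_comp
  -- Differentiate `fourier_symbol_eq_zero` at `y = r ξ^⊥` in the direction `ξ`.
  have hD := (((hd A).mul ((hl 1).pow 2)).sub (((hd B).const_mul 2).mul ((hl 0).mul (hl 1)))).add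
    ((hd C).mul ((hl 0).pow 2))
  have hz := hD.unique ((hasDerivAt_const (0 : ℝ) (0 : ℂ)).congr_of_eventuallyEq
    (Eventually.of_forall fun s => hsym (y + s • ξ)))
  have hy0 : (y 0 : ℂ) = -(r * ξ 1) := by simp [hy]
  have hy1 : (y 1 : ℂ) = r * ξ 0 := by simp [hy]
  simp only [Pi.mul_apply, Pi.pow_apply, zero_smul, add_zero, hy0, hy1, Nat.cast_ofNat,
    Nat.add_one_sub_one, pow_one] at hz ⊢
  -- The contraction of `F(y)` with `ξ` and `ξ^⊥`; `e0` is the one with `ξ` and `ξ`.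
  have hX : (r : ℂ) * (ξ 1 * (ξ 0 * A y + ξ 1 * B y) - ξ 0 * (ξ 0 * B y + ξ 1 * C y)) = 0 := by
    linear_combination (1 / 2 : ℂ) * hz - (1 / 2 : ℂ) * (r : ℂ) ^ 2 * e1
  constructor
  · linear_combination (r * ξ 0 : ℂ) * e0 + (ξ 1 : ℂ) * hX -
      (r : ℂ) * (ξ 0 * A y + ξ 1 * B y) * hsq
  · linear_combination (r * ξ 1 : ℂ) * e0 - (ξ 0 : ℂ) * hX -
      (r : ℂ) * (ξ 0 * B y + ξ 1 * C y) * hsq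

/-- The standard basis vectors of the plane. -/
noncomputable abbrev basisVec (i : Fin 2) : E 2 := EuclideanSpace.single i 1

/-- Equality of the mixed derivatives `∂₂ g = ∂₁ h`, read off from the Fourier side. -/
lemma lineDeriv_comm_of_fourier {g h : 𝓢(E 2, ℝ)}
    (hgh : ∀ y : E 2, (y 1 : ℂ) * 𝓕 (complexify g) y = y 0 * 𝓕 (complexify h) y) :
    ∂_{basisVec 1} g = ∂_{basisVec 0} h := by
  refine complexify_fourier_injective ?_
  ext y
  simp only [fourier_complexify_lineDeriv, inner_eq]
  simp
  linear_combination (2 * Real.pi * Complex.I) * hgh y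

/-- Each row of `f` is a closed 1-form. -/
lemma closed_of_moments {f : SchwartzSymTensorField 2 2} (h0 : momentTransform 0 f = 0)
    (h1 : momentTransform 1 f = 0) (i j : Fin 2) :
    ∂_{basisVec i} (f.comp ![0, j]) =
      ∂_{basisVec 0} (f.comp ![i, j]) := by
  have h := fun y => fourier_contract_eq_zero h0 h1 y
  fin_cases i
  · simp
  · fin_cases j
    · change ∂_{basisVec 1} (f.comp ![0, 0]) =
        ∂_{basisVec 0} (f.comp ![1, 0])
      rw [f.comp_swap 1 0]
      exact lineDeriv_comm_of_fourier fun y => (h y).1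
    · exact lineDeriv_comm_of_fourier fun y => (h y).2

lemma integral_quad_eq_zero {f : SchwartzSymTensorField 2 2} (h0 : momentTransform 0 f = 0)
    {ξ : E 2} (hξ : ‖ξ‖ = 1) : ∫ x, f.quad ξ x = 0 := by
  rw [integral_eq_integral_lines hξ (f.quad ξ).integrable]
  refine integral_eq_zero_of_ae (ae_of_all _ fun s => ?_)
  simpa using integral_line_quad h0 hξ
    (by rw [inner_smul_left, inner_perp, mul_zero] : inner ℝ (s • perp ξ) ξ = 0)

lemma integral_comp_eq_zero {f : SchwartzSymTensorField 2 2} (h0 : momentTransform 0 f = 0)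
    (i j : Fin 2) : ∫ x, f.comp ![i, j] x = 0 := by
  have key : ∀ a b : ℝ, a ^ 2 + b ^ 2 = 1 → a ^ 2 * (∫ x, f.comp ![0, 0] x) +
      2 * a * b * (∫ x, f.comp ![0, 1] x) + b ^ 2 * (∫ x, f.comp ![1, 1] x) = 0 := by
    intro a b hab
    have hξ : ‖(!₂[a, b] : E 2)‖ = 1 := by
      rw [← sq_eq_sq₀ (norm_nonneg _) zero_le_one, norm_sq_eq]
      simpa using hab
    have h := integral_quad_eq_zero h0 hξ
    simp only [f.quad_apply_two] at h
    have hi := fun I => (f.comp I).integrable (μ := volume)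
    have hadd : Integrable fun x => a ^ 2 * f.comp ![0, 0] x + 2 * a * b * f.comp ![0, 1] x :=
      ((hi ![0, 0]).const_mul (a ^ 2)).add ((hi ![0, 1]).const_mul (2 * a * b))
    change ∫ x, (a ^ 2 * f.comp ![0, 0] x + 2 * a * b * f.comp ![0, 1] x) +
      b ^ 2 * f.comp ![1, 1] x = 0 at h
    rw [integral_add hadd ((hi _).const_mul _),
      integral_add ((hi _).const_mul _) ((hi _).const_mul _), integral_const_mul,
      integral_const_mul, integral_const_mul] at h
    exact h
  have k0 := key 1 0 (by norm_num)
  have k1 := key 0 1 (by norm_num)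
  -- Any unit vector off the axes isolates the mixed component.
  have k2 := key (3 / 5) (4 / 5) (by norm_num)
  have h01 : ∫ x, f.comp ![0, 1] x = 0 := by linarith
  fin_cases i <;> fin_cases j
  · simpa using k0
  · exact h01
  · simpa [f.comp_swap 1 0] using h01
  · simpa using k1

/-! ### Second derivatives and the potential -/

/-- The symmetrizations in `d²v` reduce to averaging over the order of the two derivatives. -/
lemma dSq_apply {n : ℕ} (v : E n → ℝ) (x : E n) (I : Fin 2 → Fin n) :
    dSq v x I = (2 : ℝ)⁻¹ * (partialDeriv (I 1) (partialDeriv (I 0) v) x +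
      partialDeriv (I 0) (partialDeriv (I 1) v) x) := by
  have hu : (Finset.univ : Finset (Equiv.Perm (Fin 2))) = {1, Equiv.swap 0 1} := by decide
  have h1 : ∀ (y : E n) (J : Fin 1 → Fin n),
      innerDeriv (scalarField v) y J = partialDeriv (J 0) v y := by
    intro y J
    simp [innerDeriv, symmetrize, scalarField]
  rw [dSq]
  generalize hw : innerDeriv (m := 0) (scalarField v) = w
  simp only [innerDeriv, symmetrize, hu]
  rw [Finset.sum_pair (by decide)]
  simp only [← hw, h1]
  simp [Nat.factorial]

lemma partialDeriv_partialDeriv {n : ℕ} {v : E n → ℝ} (hv : ContDiff ℝ ∞ v) (i j : Fin n)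
    (x : E n) : partialDeriv j (partialDeriv i v) x =
      fderiv ℝ (fderiv ℝ v) x (EuclideanSpace.single j 1) (EuclideanSpace.single i 1) := by
  have hd : DifferentiableAt ℝ (fderiv ℝ v) x :=
    (hv.fderiv_right (m := ∞) le_rfl).differentiable (by simp) x
  have := (hd.hasFDerivAt.clm_apply (hasFDerivAt_const (EuclideanSpace.single i (1 : ℝ)) x)).fderiv
  change fderiv ℝ (fun y => fderiv ℝ v y (EuclideanSpace.single i 1)) x _ = _
  rw [this]
  simp

lemma quad_eq_fderiv {f : SchwartzSymTensorField 2 2} {v : E 2 → ℝ} (hv : ContDiff ℝ ∞ v)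
    (hf : f.toField = dSq v) (ξ x : E 2) :
    f.quad ξ x = fderiv ℝ (fderiv ℝ v) x ξ ξ := by
  have hξ : ξ = ξ 0 • basisVec 0 + ξ 1 • basisVec 1 := by
    ext i
    fin_cases i <;> simp
  conv_rhs => rw [hξ]
  simp only [f.quad_apply, hf, dSq_apply, partialDeriv_partialDeriv hv, Fin.sum_univ_two, map_add,
    map_smul, add_apply, smul_apply, smul_eq_mul]
  simp
  ring

lemma momentTransform_eq_zero_of_dSq {f : SchwartzSymTensorField 2 2} {v : E 2 → ℝ}
    (hv : ContDiff ℝ ∞ v) (hv0 : Tendsto v (cocompact (E 2)) (𝓝 0)) (hf : f.toField = dSq v) :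
    momentTransform 0 f = 0 ∧ momentTransform 1 f = 0 := by
  suffices h : ∀ x ξ : E 2, ‖ξ‖ = 1 →
      ∫ t : ℝ, f.quad ξ (x + t • ξ) = 0 ∧ ∫ t : ℝ, t * f.quad ξ (x + t • ξ) = 0 by
    constructor <;> funext p
    · simpa [momentTransform, SchwartzSymTensorField.quad_apply] using (h p.1.1 p.1.2 p.2.1).1
    · simpa [momentTransform, SchwartzSymTensorField.quad_apply] using (h p.1.1 p.1.2 p.2.1).2
  intro x ξ hξ
  have hl : ∀ t : ℝ, HasDerivAt (fun t : ℝ => x + t • ξ) ξ t := fun t => by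
    simpa using ((hasDerivAt_id t).smul_const ξ).const_add x
  have hv1 : Differentiable ℝ v := hv.differentiable (by simp)
  have hv2 : Differentiable ℝ (fderiv ℝ v) :=
    (hv.fderiv_right (m := ∞) le_rfl).differentiable (by simp)
  have hto : Tendsto (fun t : ℝ => x + t • ξ) (cocompact ℝ) (cocompact (E 2)) := by
    rw [← Metric.cobounded_eq_cocompact (α := E 2), ← tendsto_norm_atTop_iff_cobounded]
    have hn : ∀ t : ℝ, ‖t‖ - ‖x‖ ≤ ‖x + t • ξ‖ := fun t => by
      have := norm_sub_le (x + t • ξ) x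
      rw [add_sub_cancel_left, norm_smul, hξ, mul_one] at this
      linarith
    exact tendsto_atTop_mono hn
      (tendsto_atTop_add_const_right _ (-‖x‖) (tendsto_norm_cocompact_atTop (E := ℝ)))
  have h0 := integrable_line (f.quad ξ) hξ 0 x
  have h1 := integrable_line (f.quad ξ) hξ 1 x
  simp only [pow_zero, pow_one, one_mul, smul_eq_mul] at h0 h1
  refine integral_moments_eq_zero (φ := fun t => v (x + t • ξ))
    (φ' := fun t => fderiv ℝ v (x + t • ξ) ξ) (fun t => ?_) (fun t => ?_) ?_ ?_ h0 h1
  · exact (hv1 _).hasFDerivAt.comp_hasDerivAt t (hl t)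
  · rw [quad_eq_fderiv hv hf]
    have := ((hv2 _).hasFDerivAt.comp_hasDerivAt t (hl t)).clm_apply (hasDerivAt_const t ξ)
    simpa using this
  · exact (hv0.comp hto).mono_left atTop_le_cocompact
  · exact (hv0.comp hto).mono_left atBot_le_cocompact

lemma norm_basisVec (i : Fin 2) : ‖basisVec i‖ = 1 := by simp

lemma partialDeriv_rayMoment (q : ℕ) (i : Fin 2) (h : 𝓢(E 2, ℝ)) :
    partialDeriv i (rayMoment q (basisVec 0) h) =
      rayMoment q (basisVec 0) (∂_{basisVec i} h) :=
  funext fun x => fderiv_rayMoment_apply q (norm_basisVec 0) h x _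

/-- The first moment of `f₁₁` over rays in the direction `e₁` is a potential of a closed `f`: closedness
turns derivatives of the integrand into `∂₁`-derivatives, which integration by parts removes. -/
lemma partialDeriv_partialDeriv_rayMoment {f : SchwartzSymTensorField 2 2}
    (h0 : momentTransform 0 f = 0) (h1 : momentTransform 1 f = 0) (i j : Fin 2) (x : E 2) :
    partialDeriv j (partialDeriv i (rayMoment 1 (basisVec 0) (f.comp ![0, 0]))) x =
      f.comp ![i, j] x := by
  have hi : partialDeriv i (rayMoment 1 (basisVec 0) (f.comp ![0, 0])) =
      -rayMoment 0 (basisVec 0) (f.comp ![0, i]) := by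
    rw [partialDeriv_rayMoment, closed_of_moments h0 h1, f.comp_swap i 0]
    funext y
    exact rayMoment_one_lineDeriv (norm_basisVec 0) _ y
  have hneg : partialDeriv j (-rayMoment 0 (basisVec 0) (f.comp ![0, i])) x =
      -partialDeriv j (rayMoment 0 (basisVec 0) (f.comp ![0, i])) x := by
    simp [partialDeriv, fderiv_neg]
  rw [hi, hneg, partialDeriv_rayMoment, closed_of_moments h0 h1,
    rayMoment_zero_lineDeriv (norm_basisVec 0), neg_neg, f.comp_swap]

lemma tendsto_rayMoment_cocompact {f : SchwartzSymTensorField 2 2}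
    (h0 : momentTransform 0 f = 0) (h1 : momentTransform 1 f = 0) :
    Tendsto (rayMoment 1 (basisVec 0) (f.comp ![0, 0])) (cocompact (E 2)) (𝓝 0) := by
  obtain ⟨C, hC⟩ := exists_norm_rayMoment_le (f.comp ![0, 0])
  have hq : f.quad (basisVec 0) = f.comp ![0, 0] := by
    ext x
    simp [f.quad_apply_two]
  have hb : ∀ x, ‖rayMoment 1 (basisVec 0) (f.comp ![0, 0]) x‖ ≤ C * (1 + ‖x‖)⁻¹ := by
    intro x
    rcases le_total 0 (inner ℝ x (basisVec 0)) with hx | hx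
    · exact hC _ (norm_basisVec 0) x hx
    · have hz := integral_mul_line_quad h0 h1 x (norm_basisVec 0)
      rw [hq] at hz
      rw [rayMoment_one_eq_opposite (norm_basisVec 0) _ x hz]
      exact hC _ (by rw [norm_neg, norm_basisVec]) x (by rwa [inner_neg_right, neg_nonneg])
  refine squeeze_zero_norm hb ?_
  rw [← mul_zero C]
  exact (Tendsto.inv_tendsto_atTop
    (tendsto_atTop_add_const_left _ 1 tendsto_norm_cocompact_atTop)).const_mul C

end MomentumRay

theorem mainTheorem2 (f : MomentumRay.SchwartzSymTensorField 2 2) :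
    ((MomentumRay.momentTransform 0 f = 0 ∧ MomentumRay.momentTransform 1 f = 0) ↔
      ∃ v : MomentumRay.E 2 → ℝ, ContDiff ℝ ∞ v ∧
        Filter.Tendsto v (Filter.cocompact (MomentumRay.E 2)) (𝓝 0) ∧
        f.toField = MomentumRay.dSq v) ∧
    (MomentumRay.momentTransform 0 f = 0 →
      ∀ i j : Fin 2, ∫ x : MomentumRay.E 2, f.toField x ![i, j] = 0) := by
  refine ⟨⟨fun ⟨h0, h1⟩ => ?_, fun ⟨v, hv, hv0, hf⟩ =>
    MomentumRay.momentTransform_eq_zero_of_dSq hv hv0 hf⟩,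
    fun h0 i j => MomentumRay.integral_comp_eq_zero h0 i j⟩
  -- The potential is `x ↦ ∫₀^∞ s f₁₁(x + s e₁) ds`.
  refine ⟨_, MomentumRay.contDiff_rayMoment 1 (MomentumRay.norm_basisVec 0) (f.comp ![0, 0]),
    MomentumRay.tendsto_rayMoment_cocompact h0 h1, ?_⟩
  funext x I
  obtain ⟨i, j, rfl⟩ : ∃ i j, I = ![i, j] := ⟨I 0, I 1, by ext k; fin_cases k <;> rfl⟩
  rw [MomentumRay.dSq_apply, MomentumRay.partialDeriv_partialDeriv_rayMoment h0 h1,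
    MomentumRay.partialDeriv_partialDeriv_rayMoment h0 h1]
  change f.comp ![i, j] x = 2⁻¹ * (f.comp ![i, j] x + f.comp ![j, i] x)
  rw [f.comp_swap j i]
  ring
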